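/- Let $D$ be an integral domain with quotient field $K$. For a nonzero $D$-submodule $E$ of $K$ put $E^{-1}=\{x\in K : xE\subseteq D\}$ and $E^{v}=(E^{-1})^{-1}$. For a nonzero fractional ideal $E$ of $D$ put $E^{t}=\bigcup\{F^{v} : F\subseteq E \text{ a nonzero finitely generated } D\text{-submodule}\}$. A nonzero ideal $I$ of $D$ is divisorial if $I^{v}=I$ and is a $t$-ideal if $I^{t}=I$; a $t$-prime is a prime $t$-ideal, and a $t$-maximal ideal is an ideal that is maximal in the set of proper $t$-ideals. The domain $D$ is a Prüfer $v$-multiplication domain (P$v$MD) if $(II^{-1})^{t}=D$ for every nonzero finitely generated ideal $I$ of $D$. A $t$-prime $P$ is $t$-sharp if $\bigcap\{D_M : M \text{ is } t\text{-maximal and } P\nsubseteq M\}\nsubseteq D_P$ (localizations are taken inside $K$, and an empty intersection is $K$), and $D$ is $t$-doublesharp if every $t$-prime of $D$ is $t$-sharp. If $D$ is a $t$-doublesharp P$v$MD and $P$ is a $t$-prime of $D$ that is not $t$-maximal, then $P$ is divisorial. -/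

import Mathlib

namespace TOperation

variable {D : Type*} [CommRing D] {K : Type*} [Field K] [Algebra D K]

/-- `E ^ v = (E⁻¹)⁻¹` for a `D`-submodule `E` of `K`, where `E⁻¹ = 1 / E` is the
submodule `{x ∈ K | x E ⊆ D}` (the unit submodule `1` is the image of `D` in `K`). -/
def vClosure (E : Submodule D K) : Submodule D K :=
  1 / (1 / E)

/-- `E ^ t` is the union (see `mem_tClosure_iff`) of the `F ^ v`, where `F` ranges over the nonzero
finitely generated `D`-submodules of `E`. -/
def tClosure (E : Submodule D K) : Submodule D K :=
  ⨆ F : {F : Submodule D K // F ≠ ⊥ ∧ F.FG ∧ F ≤ E}, vClosure F.1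

theorem vClosure_mono {E F : Submodule D K} (h : E ≤ F) :
    vClosure E ≤ vClosure F := by
  intro x hx
  rw [vClosure, Submodule.mem_div_iff_forall_mul_mem] at hx ⊢
  intro y hy
  refine hx y ?_
  rw [Submodule.mem_div_iff_forall_mul_mem] at hy ⊢
  exact fun z hz => hy z (h hz)

theorem mem_tClosure_iff {E : Submodule D K} (hE : E ≠ ⊥)
    (x : K) :
    x ∈ tClosure E ↔ ∃ F : Submodule D K, F ≠ ⊥ ∧ F.FG ∧ F ≤ E ∧ x ∈ vClosure F := by
  obtain ⟨e, he, he0⟩ := Submodule.exists_mem_ne_zero_of_ne_bot hE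
  have : Nonempty {F : Submodule D K // F ≠ ⊥ ∧ F.FG ∧ F ≤ E} :=
    ⟨⟨Submodule.span D {e}, by simpa using he0, Submodule.fg_span_singleton e,
      by simpa [Submodule.span_le] using he⟩⟩
  rw [tClosure, Submodule.mem_iSup_of_directed]
  · constructor
    · rintro ⟨⟨F, h0, h1, h2⟩, hx⟩
      exact ⟨F, h0, h1, h2, hx⟩
    · rintro ⟨F, h0, h1, h2, hx⟩
      exact ⟨⟨F, h0, h1, h2⟩, hx⟩
  · rintro ⟨F, h0, h1, h2⟩ ⟨G, g0, g1, g2⟩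
    exact ⟨⟨F ⊔ G, fun h => h0 (le_bot_iff.1 (h ▸ le_sup_left)), h1.sup g1, sup_le h2 g2⟩,
      vClosure_mono le_sup_left, vClosure_mono le_sup_right⟩

variable (K)

/-- A divisorial ideal: a nonzero ideal `I` of `D`, regarded inside `K`, with `I ^ v = I`. -/
def IsDivisorial (I : Ideal D) : Prop :=
  I ≠ ⊥ ∧ vClosure (IsLocalization.coeSubmodule K I) = IsLocalization.coeSubmodule K I

/-- A `t`-ideal: a nonzero ideal `I` with `I ^ t = I`. -/
def IsTIdeal (I : Ideal D) : Prop :=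
  I ≠ ⊥ ∧ tClosure (IsLocalization.coeSubmodule K I) = IsLocalization.coeSubmodule K I

/-- A `t`-prime: a prime `t`-ideal. -/
def IsTPrime (P : Ideal D) : Prop :=
  P.IsPrime ∧ IsTIdeal K P

/-- A `t`-maximal ideal: an ideal maximal among the proper `t`-ideals. -/
def IsTMaximal (M : Ideal D) : Prop :=
  Maximal (fun I : Ideal D => I ≠ ⊤ ∧ IsTIdeal K I) M

/-- A domain is a Prüfer `v`-multiplication domain if every nonzero finitely generated ideal `I`
is `t`-invertible, i.e. `(I I⁻¹) ^ t = D`. -/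
def IsPvMD (D : Type*) [CommRing D] (K : Type*) [Field K] [Algebra D K] : Prop :=
  ∀ I : Ideal D, I ≠ ⊥ → I.FG →
    tClosure (IsLocalization.coeSubmodule K I * (1 / IsLocalization.coeSubmodule K I)) = 1

/-- The localization `D_P`, as the set of fractions `a / s` in `K` with `s ∉ P`. -/
def localizationAt (P : Ideal D) : Set K :=
  {x | ∃ a s : D, s ∉ P ∧ x = algebraMap D K a / algebraMap D K s}

/-- For a prime `P`, the set `localizationAt K P` is Mathlib's localization of `D` at `P`
inside `K`. -/
theorem localizationAt_eq [IsDomain D] [IsFractionRing D K] (P : Ideal D) [hP : P.IsPrime] :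
    localizationAt K P =
      (Localization.subalgebra.ofField K P.primeCompl P.primeCompl_le_nonZeroDivisors : Set K) := by
  ext x
  constructor
  · rintro ⟨a, s, hs, rfl⟩
    exact ⟨a, s, hs, div_eq_mul_inv _ _⟩
  · rintro ⟨a, s, hs, rfl⟩
    exact ⟨a, s, hs, (div_eq_mul_inv _ _).symm⟩

/-- `Θ ^ t (P)`: the intersection in `K` of the `D_M`, where `M` ranges over the `t`-maximal ideals
not containing `P` (it is `K` if there are none). -/
def tTheta (P : Ideal D) : Set K :=
  ⋂ M ∈ {M : Ideal D | IsTMaximal K M ∧ ¬ P ≤ M}, localizationAt K M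

/-- `P` is `t`-sharp if `Θ ^ t (P) ⊈ D_P`. -/
def IsTSharp (P : Ideal D) : Prop :=
  ¬ tTheta K P ⊆ localizationAt K P

/-- `D` is `t`-doublesharp if every `t`-prime of `D` is `t`-sharp. -/
def IsTDoublesharp (D : Type*) [CommRing D] (K : Type*) [Field K] [Algebra D K] : Prop :=
  ∀ P : Ideal D, IsTPrime K P → IsTSharp K P

end TOperation

namespace TOperation

/-! ### Elementary properties of the `v`- and `t`-closures, and existence of `t`-maximal ideals. -/

variable {D : Type*} [CommRing D] {K : Type*} [Field K] [Algebra D K]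

/-! Let `M` be a `t`-maximal ideal above `P`. A failure of divisoriality yields `x ∈ M` with `x ∈
P^v`, `x ∉ P`. Take a prime `Q ≤ M` minimal over `P + (x)`; it is a `t`-prime
(`IsPvMD.isTPrime_of_le`), so sharpness gives a finitely generated `G ≤ Q` such that every
`t`-maximal ideal above `G` is above `Q` (`IsPvMD.exists_fg_of_isTSharp`). Since `D_M` is a
valuation domain, `G + (x)` is generated there by a single `g`. A suitable `u = s / g` with `s ∉ M`
lies in `D_P` and in `D_N` for every `t`-maximal `N` not above `P`, but not in `D_Q`. Then all `u ^
n` lie in `P⁻¹` (`IsPvMD.pow_mul_mem_one`), hence `x * u ^ n ∈ D`. The `d` with `d * u ^ n ∈ D_M`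
for all `n` form a prime (`IsPvMD.exists_isPrime_mem_iff`) that contains `P` and `x` and lies in
`Q`, so it is `Q` and contains `g`. But `g * u ^ 2 = s * u ∉ D_M`. -/

theorem mem_vClosure_iff {E : Submodule D K} {x : K} :
    x ∈ vClosure E ↔ ∀ y : K, (∀ e ∈ E, y * e ∈ (1 : Submodule D K)) →
      x * y ∈ (1 : Submodule D K) := by
  simp only [vClosure, Submodule.mem_div_iff_forall_mul_mem]

theorem le_vClosure (E : Submodule D K) : E ≤ vClosure E := fun x hx =>
  mem_vClosure_iff.2 fun y hy => mul_comm x y ▸ hy x hx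

theorem vClosure_le_one {E : Submodule D K} (hE : E ≤ 1) : vClosure E ≤ 1 := fun x hx => by
  simpa using mem_vClosure_iff.1 hx 1 fun e he => by simpa using hE he

theorem tClosure_mono {E F : Submodule D K} (h : E ≤ F) : tClosure E ≤ tClosure F :=
  iSup_le fun G => le_iSup (fun H : {H : Submodule D K // H ≠ ⊥ ∧ H.FG ∧ H ≤ F} => vClosure H.1)
    ⟨G.1, G.2.1, G.2.2.1, G.2.2.2.trans h⟩

theorem exists_coeSubmodule_eq {E : Submodule D K} (hE : E ≤ 1) :
    ∃ I : Ideal D, IsLocalization.coeSubmodule K I = E := by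
  refine ⟨E.comap (Algebra.linearMap D K), ?_⟩
  rw [IsLocalization.coeSubmodule, Submodule.map_comap_eq, inf_eq_right]
  rwa [Submodule.one_eq_range] at hE

theorem coeSubmodule_le_one (I : Ideal D) : IsLocalization.coeSubmodule K I ≤ 1 := by
  rw [← IsLocalization.coeSubmodule_top K]
  exact IsLocalization.coeSubmodule_mono K le_top

/-- A finitely generated submodule of a product `E * E'` lies in `E * B` for a finitely generated
submodule `B` of `E'`. -/
theorem exists_fg_le_mul {E E' F : Submodule D K} (hF : F.FG) (h : F ≤ E * E') :
    ∃ B ≤ E', B.FG ∧ F ≤ E * B := by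
  induction F, hF using Submodule.fg_induction with
  | singleton x =>
    rw [Submodule.span_singleton_le_iff_mem] at h
    simp only [Submodule.span_singleton_le_iff_mem]
    induction h using Submodule.mul_induction_on' with
    | mem_mul_mem m hm n hn =>
      exact ⟨Submodule.span D {n}, by simpa [Submodule.span_le] using hn,
        Submodule.fg_span_singleton n,
        Submodule.mul_mem_mul hm (Submodule.mem_span_singleton_self n)⟩
    | add x _ y _ hx hy =>
      obtain ⟨B, hB, hBf, hxB⟩ := hx
      obtain ⟨C, hC, hCf, hyC⟩ := hy
      exact ⟨B ⊔ C, sup_le hB hC, hBf.sup hCf,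
        add_mem ((mul_le_mul' le_rfl le_sup_left : E * B ≤ E * (B ⊔ C)) hxB)
          ((mul_le_mul' le_rfl le_sup_right : E * C ≤ E * (B ⊔ C)) hyC)⟩
  | sup F₁ F₂ _ _ h₁ h₂ =>
    obtain ⟨B, hB, hBf, hxB⟩ := h₁ (le_sup_left.trans h)
    obtain ⟨C, hC, hCf, hyC⟩ := h₂ (le_sup_right.trans h)
    exact ⟨B ⊔ C, sup_le hB hC, hBf.sup hCf,
      sup_le (hxB.trans (mul_le_mul' le_rfl le_sup_left))
        (hyC.trans (mul_le_mul' le_rfl le_sup_right))⟩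

theorem IsTIdeal.vClosure_le {I : Ideal D} (hI : IsTIdeal K I) {F : Submodule D K} (h0 : F ≠ ⊥)
    (hF : F.FG) (hFI : F ≤ IsLocalization.coeSubmodule K I) :
    vClosure F ≤ IsLocalization.coeSubmodule K I := by
  rw [← hI.2]
  exact le_iSup (fun H : {H : Submodule D K // H ≠ ⊥ ∧ H.FG ∧
    H ≤ IsLocalization.coeSubmodule K I} => vClosure H.1) ⟨F, h0, hF, hFI⟩

theorem localizationAt_anti {P Q : Ideal D} (h : P ≤ Q) :
    localizationAt K Q ⊆ localizationAt K P := by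
  rintro x ⟨a, s, hs, rfl⟩
  exact ⟨a, s, fun h' => hs (h h'), rfl⟩

variable [IsFractionRing D K]

theorem algebraMap_mem_coeSubmodule {I : Ideal D} {z : D} :
    algebraMap D K z ∈ IsLocalization.coeSubmodule K I ↔ z ∈ I := by
  rw [IsLocalization.mem_coeSubmodule]
  exact ⟨fun ⟨y, hy, h⟩ => IsFractionRing.injective D K h ▸ hy, fun h => ⟨z, h, rfl⟩⟩

theorem mem_localizationAt_iff {P : Ideal D} {x : K} :
    x ∈ localizationAt K P ↔ ∃ a s : D, s ∉ P ∧ algebraMap D K s * x = algebraMap D K a := by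
  have key : ∀ s : D, s ∉ P → algebraMap D K s ≠ 0 := fun s hs h =>
    hs (((map_eq_zero_iff _ (IsFractionRing.injective D K)).1 h).symm ▸ P.zero_mem)
  constructor
  · rintro ⟨a, s, hs, rfl⟩
    exact ⟨a, s, hs, mul_div_cancel₀ _ (key s hs)⟩
  · rintro ⟨a, s, hs, h⟩
    exact ⟨a, s, hs, by rw [eq_div_iff (key s hs), mul_comm, h]⟩

theorem IsTIdeal.mem_of_mem_vClosure {I : Ideal D} (hI : IsTIdeal K I) {J : Ideal D} (h0 : J ≠ ⊥)
    (hJ : J.FG) (hJI : J ≤ I) {z : D}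
    (hz : algebraMap D K z ∈ vClosure (IsLocalization.coeSubmodule K J)) : z ∈ I := by
  refine algebraMap_mem_coeSubmodule.1 (hI.vClosure_le (K := K) ?_ ?_ ?_ hz)
  · obtain ⟨j, hj, hj0⟩ := Submodule.exists_mem_ne_zero_of_ne_bot h0
    exact Submodule.ne_bot_iff _ |>.2 ⟨algebraMap D K j, algebraMap_mem_coeSubmodule.2 hj,
      by simpa using hj0⟩
  · exact (IsLocalization.coeSubmodule_fg K (IsFractionRing.injective D K) J).2 hJ
  · exact IsLocalization.coeSubmodule_mono K hJI

/-- Finitely generated submodules of `I`, and their `v`-closures, lie in `D`, so it suffices to test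
ideals and elements of `D`. -/
theorem isTIdeal_of_forall {I : Ideal D} (hI : I ≠ ⊥)
    (h : ∀ J : Ideal D, J ≠ ⊥ → J.FG → J ≤ I → ∀ z : D,
      algebraMap D K z ∈ vClosure (IsLocalization.coeSubmodule K J) → z ∈ I) :
    IsTIdeal K I := by
  refine ⟨hI, le_antisymm (iSup_le ?_) ?_⟩
  · rintro ⟨F, h0, hF, hFI⟩ x hx
    obtain ⟨J, rfl⟩ := exists_coeSubmodule_eq (hFI.trans (coeSubmodule_le_one I))
    obtain ⟨z, rfl⟩ := Submodule.mem_one.1 (vClosure_le_one (coeSubmodule_le_one J) hx)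
    refine algebraMap_mem_coeSubmodule.2 (h J ?_ ?_ ?_ z hx)
    · rintro rfl
      exact h0 (IsLocalization.coeSubmodule_bot K)
    · exact (IsLocalization.coeSubmodule_fg K (IsFractionRing.injective D K) J).1 hF
    · exact fun j hj => algebraMap_mem_coeSubmodule.1 (hFI (algebraMap_mem_coeSubmodule.2 hj))
  · intro x hx
    by_cases hx0 : x = 0
    · exact hx0 ▸ zero_mem _
    · have h1 := le_iSup (fun H : {H : Submodule D K // H ≠ ⊥ ∧ H.FG ∧
        H ≤ IsLocalization.coeSubmodule K I} => vClosure H.1) ⟨Submodule.span D {x},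
          by simpa using hx0, Submodule.fg_span_singleton x,
          by simpa [Submodule.span_le] using hx⟩
      exact h1 (le_vClosure _ (Submodule.mem_span_singleton_self x))

/-- Every proper `t`-ideal is contained in a `t`-maximal ideal. -/
theorem IsTIdeal.exists_le_isTMaximal {I : Ideal D} (hI : IsTIdeal K I) (hne : I ≠ ⊤) :
    ∃ M, I ≤ M ∧ IsTMaximal K M := by
  refine zorn_le_nonempty₀ {I : Ideal D | I ≠ ⊤ ∧ IsTIdeal K I} ?_ I ⟨hne, hI⟩
  intro c hc hchain y hy
  have hdir : DirectedOn (· ≤ ·) c := hchain.directedOn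
  refine ⟨sSup c, ⟨?_, isTIdeal_of_forall ?_ ?_⟩, fun z hz => le_sSup hz⟩
  · rw [Ideal.ne_top_iff_one, Submodule.mem_sSup_of_directed ⟨y, hy⟩ hdir]
    rintro ⟨J, hJ, h1⟩
    exact (hc hJ).1 ((Ideal.eq_top_iff_one J).2 h1)
  · exact fun h => (hc hy).2.1 (le_bot_iff.1 (h ▸ le_sSup hy))
  · intro J h0 hJ hJc z hz
    -- Being finitely generated, `J` already lies in one member of the chain.
    obtain ⟨L, hL, hJL⟩ :=
      (Submodule.fg_iff_compact J).1 hJ c _ ⟨y, hy⟩ hdir (isLUB_sSup c) hJc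
    exact le_sSup hL ((hc hL).2.mem_of_mem_vClosure h0 hJ hJL hz)

theorem algebraMap_mem_localizationAt {P : Ideal D} (hP : P.IsPrime) (d : D) :
    algebraMap D K d ∈ localizationAt K P :=
  mem_localizationAt_iff.2 ⟨d, 1, hP.one_notMem, by simp⟩

/-! ### Local structure of a PvMD at a `t`-prime. -/

/-- The localization of a PvMD at a `t`-prime is a valuation domain. -/
theorem IsPvMD.exists_mul_eq_mul (hD : IsPvMD D K) {M : Ideal D} (hM : IsTPrime K M) (a b : D) :
    (∃ s ∉ M, ∃ c, s * a = c * b) ∨ ∃ s ∉ M, ∃ c, s * b = c * a := by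
  by_cases hb0 : b = 0
  · exact Or.inr ⟨1, hM.1.one_notMem, 0, by simp [hb0]⟩
  set J : Ideal D := Ideal.span {a, b} with hJ
  have haJ : a ∈ J := Ideal.subset_span (by simp)
  have hbJ : b ∈ J := Ideal.subset_span (by simp)
  have h1 := hD J ((Submodule.ne_bot_iff _).2 ⟨b, hbJ, hb0⟩) (Submodule.fg_span (Set.toFinite _))
  -- As `J J⁻¹` escapes `M`, some `n ∈ J⁻¹` makes `n * a` or `n * b` an element of `D` outside `M`.
  have hnot : ¬ IsLocalization.coeSubmodule K J * (1 / IsLocalization.coeSubmodule K J) ≤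
      IsLocalization.coeSubmodule K M := fun h => by
    have h2 := tClosure_mono h
    rw [h1, hM.2.2] at h2
    exact hM.1.one_notMem (algebraMap_mem_coeSubmodule.1 (h2 (Submodule.mem_one.2 ⟨1, rfl⟩)))
  rw [Submodule.mul_le] at hnot
  push Not at hnot
  obtain ⟨m, hm, n, hn, hmn⟩ := hnot
  obtain ⟨j, hj, rfl⟩ := (IsLocalization.mem_coeSubmodule K J).1 hm
  obtain ⟨r, t, rfl⟩ := Ideal.mem_span_pair.1 hj
  rw [Submodule.mem_div_iff_forall_mul_mem] at hn
  obtain ⟨a', ha'⟩ := Submodule.mem_one.1 (hn _ (algebraMap_mem_coeSubmodule.2 haJ))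
  obtain ⟨b', hb'⟩ := Submodule.mem_one.1 (hn _ (algebraMap_mem_coeSubmodule.2 hbJ))
  have hcross : a' * b = b' * a := by
    apply IsFractionRing.injective D K
    rw [map_mul, map_mul, ha', hb']
    ring
  have hsum : r * a' + t * b' ∉ M := fun h => hmn <| by
    have := algebraMap_mem_coeSubmodule (K := K).2 h
    rw [map_add, map_mul, map_mul, ha', hb'] at this
    convert this using 1
    rw [map_add, map_mul, map_mul]
    ring
  by_cases h : a' ∈ M
  · refine Or.inl ⟨b', fun h' => hsum ?_, a', hcross.symm⟩
    exact M.add_mem (M.mul_mem_left _ h) (M.mul_mem_left _ h')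
  · exact Or.inr ⟨a', h, b', hcross⟩

/-- In a PvMD a finitely generated ideal is locally principal at a `t`-prime. -/
theorem IsPvMD.exists_forall_dvd (hD : IsPvMD D K) {M : Ideal D} (hM : IsTPrime K M) {J : Ideal D}
    (hJ : J.FG) : ∃ f ∈ J, ∃ s ∉ M, ∀ j ∈ J, f ∣ s * j := by
  induction J, hJ using Submodule.fg_induction with
  | singleton x =>
    refine ⟨x, Submodule.mem_span_singleton_self x, 1, hM.1.one_notMem, fun j hj => ?_⟩
    rw [one_mul]
    exact Ideal.mem_span_singleton.1 hj
  | sup J₁ J₂ _ _ h₁ h₂ =>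
    have key : ∀ J₁ J₂ : Ideal D, ∀ f₁ f₂ s₁ s₂ s c : D, (∀ j ∈ J₁, f₁ ∣ s₁ * j) →
        (∀ j ∈ J₂, f₂ ∣ s₂ * j) → s * f₁ = c * f₂ → ∀ j ∈ J₁ ⊔ J₂, f₂ ∣ s * s₁ * s₂ * j := by
      intro J₁ J₂ f₁ f₂ s₁ s₂ s c h₁ h₂ h j hj
      obtain ⟨j₁, hj₁, j₂, hj₂, rfl⟩ := Submodule.mem_sup.1 hj
      obtain ⟨k₁, hk₁⟩ := h₁ j₁ hj₁
      obtain ⟨k₂, hk₂⟩ := h₂ j₂ hj₂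
      exact ⟨c * s₂ * k₁ + s * s₁ * k₂, by
        linear_combination s * s₂ * hk₁ + s₂ * k₁ * h + s * s₁ * hk₂⟩
    obtain ⟨f₁, hf₁, s₁, hs₁, h₁⟩ := h₁
    obtain ⟨f₂, hf₂, s₂, hs₂, h₂⟩ := h₂
    have hmul : ∀ s ∉ M, ∀ t ∉ M, s * t ∉ M := fun s hs t ht h =>
      (hM.1.mem_or_mem h).elim hs ht
    rcases hD.exists_mul_eq_mul hM f₁ f₂ with ⟨s, hs, c, h⟩ | ⟨s, hs, c, h⟩
    · exact ⟨f₂, Submodule.mem_sup_right hf₂, _, hmul _ (hmul s hs s₁ hs₁) s₂ hs₂,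
        key J₁ J₂ f₁ f₂ s₁ s₂ s c h₁ h₂ h⟩
    · exact ⟨f₁, Submodule.mem_sup_left hf₁, _, hmul _ (hmul s hs s₂ hs₂) s₁ hs₁,
        sup_comm J₁ J₂ ▸ key J₂ J₁ f₂ f₁ s₂ s₁ s c h₂ h₁ h⟩

variable [IsDomain D]

/-! ### `t`-primes and localizations over a domain. -/

/-- A `t`-maximal ideal is prime. -/
theorem IsTMaximal.isTPrime {M : Ideal D} (hM : IsTMaximal K M) : IsTPrime K M := by
  refine ⟨⟨hM.1.1, fun {a b} hab => or_iff_not_imp_right.2 fun hb => ?_⟩, hM.1.2⟩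
  -- The colon ideal `(M : b)` is a proper `t`-ideal above `M`, because `J^v b ⊆ (J b)^v`; by
  -- maximality it is `M`.
  set C : Ideal D := Submodule.comap (LinearMap.mulRight D b) M with hC
  have memC : ∀ d, d ∈ C ↔ d * b ∈ M := fun d => Iff.rfl
  have hMC : M ≤ C := fun m hm => (memC m).2 (M.mul_mem_right b hm)
  have hb0 : b ≠ 0 := fun h => hb (h ▸ M.zero_mem)
  refine hM.2 ⟨?_, isTIdeal_of_forall (fun h => hM.1.2.1 (le_bot_iff.1 (h ▸ hMC))) ?_⟩ hMC
    ((memC a).2 hab)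
  · rw [Ideal.ne_top_iff_one, memC, one_mul]
    exact hb
  · intro J h0 hJ hJC z hz
    rw [memC]
    refine hM.1.2.mem_of_mem_vClosure (J := Submodule.map (LinearMap.mulRight D b) J) ?_ (Submodule.FG.map _ hJ)
      (Submodule.map_le_iff_le_comap.2 hJC) ?_
    · obtain ⟨j, hj, hj0⟩ := Submodule.exists_mem_ne_zero_of_ne_bot h0
      exact (Submodule.ne_bot_iff _).2 ⟨j * b, ⟨j, hj, rfl⟩, mul_ne_zero hj0 hb0⟩
    · rw [mem_vClosure_iff] at hz ⊢
      intro y hy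
      rw [map_mul, mul_assoc]
      refine hz _ fun e he => ?_
      obtain ⟨j, hj, rfl⟩ := (IsLocalization.mem_coeSubmodule K J).1 he
      have := hy (algebraMap D K (j * b)) (algebraMap_mem_coeSubmodule.2 ⟨j, hj, rfl⟩)
      convert this using 1
      rw [map_mul]
      ring

theorem mul_mem_localizationAt {P : Ideal D} (hP : P.IsPrime) {x y : K}
    (hx : x ∈ localizationAt K P) (hy : y ∈ localizationAt K P) :
    x * y ∈ localizationAt K P := by
  rw [localizationAt_eq] at *
  exact mul_mem hx hy

theorem pow_mem_localizationAt {P : Ideal D} (hP : P.IsPrime) {x : K}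
    (hx : x ∈ localizationAt K P) (n : ℕ) : x ^ n ∈ localizationAt K P := by
  rw [localizationAt_eq] at *
  exact pow_mem hx n

theorem add_mem_localizationAt {P : Ideal D} (hP : P.IsPrime) {x y : K}
    (hx : x ∈ localizationAt K P) (hy : y ∈ localizationAt K P) :
    x + y ∈ localizationAt K P := by
  rw [localizationAt_eq] at *
  exact add_mem hx hy

/-- A domain is the intersection of its localizations at the `t`-maximal ideals. -/
theorem mem_one_of_forall_isTMaximal {y : K}
    (h : ∀ N : Ideal D, IsTMaximal K N → y ∈ localizationAt K N) : y ∈ (1 : Submodule D K) := by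
  -- The ideal of denominators of `y` is a `t`-ideal; if proper, it lies in some `t`-maximal `N`,
  -- yet `y ∈ D_N` has a denominator outside `N`.
  set I : Ideal D := (1 : Submodule D K).comap (LinearMap.toSpanSingleton D K y) with hI
  have memI : ∀ d, d ∈ I ↔ algebraMap D K d * y ∈ (1 : Submodule D K) := fun d => by
    simp [hI, Algebra.smul_def]
  by_cases htop : I = ⊤
  · simpa using (memI 1).1 (htop ▸ Submodule.mem_top)
  have ht : IsTIdeal K I := by
    refine isTIdeal_of_forall ?_ ?_
    · obtain ⟨a, b, hb, rfl⟩ := IsFractionRing.div_surjective (A := D) y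
      have hb0 := nonZeroDivisors.ne_zero hb
      refine (Submodule.ne_bot_iff _).2 ⟨b, (memI b).2 ?_, hb0⟩
      rw [mul_div_cancel₀ _ (by simpa using hb0)]
      exact Submodule.mem_one.2 ⟨a, rfl⟩
    · intro J h0 hJ hJI z hz
      refine (memI z).2 (mem_vClosure_iff.1 hz y fun e he => ?_)
      obtain ⟨j, hj, rfl⟩ := (IsLocalization.mem_coeSubmodule K J).1 he
      exact mul_comm y _ ▸ (memI j).1 (hJI hj)
  obtain ⟨N, hIN, hN⟩ := ht.exists_le_isTMaximal htop
  obtain ⟨a, s, hs, has⟩ := mem_localizationAt_iff.1 (h N hN)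
  exact absurd (hIN ((memI s).2 (Submodule.mem_one.2 ⟨a, has.symm⟩))) hs

/-- In the valuation domain `D_M`, the inverse `c / t` of an element `y` outside it is a nonunit. -/
theorem IsPvMD.exists_eq_div (hD : IsPvMD D K) {M : Ideal D} (hM : IsTPrime K M) {y : K}
    (hy : y ∉ localizationAt K M) :
    ∃ c ∈ M, ∃ t ∉ M, algebraMap D K c * y = algebraMap D K t := by
  obtain ⟨a, b, hb, rfl⟩ := IsFractionRing.div_surjective (A := D) y
  have hb0 : algebraMap D K b ≠ 0 := by simpa using nonZeroDivisors.ne_zero hb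
  have hdiv : ∀ c t : D, t * b = c * a →
      algebraMap D K c * (algebraMap D K a / algebraMap D K b) = algebraMap D K t := by
    intro c t h
    rw [← mul_div_assoc, div_eq_iff hb0, ← map_mul, ← map_mul, h]
  rcases hD.exists_mul_eq_mul hM a b with ⟨s, hs, c, h⟩ | ⟨s, hs, c, h⟩
  · exact absurd (mem_localizationAt_iff.2 ⟨c, s, hs, hdiv s c h.symm⟩) hy
  · exact ⟨c, by_contra fun hc => hy (mem_localizationAt_iff.2 ⟨s, c, hc, hdiv c s h⟩), s, hs,
      hdiv c s h⟩

/-- In a PvMD a nonzero prime contained in a `t`-prime is a `t`-prime. -/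
theorem IsPvMD.isTPrime_of_le (hD : IsPvMD D K) {M Q : Ideal D} (hM : IsTPrime K M)
    (hQ : Q.IsPrime) (h0 : Q ≠ ⊥) (hQM : Q ≤ M) : IsTPrime K Q := by
  refine ⟨hQ, isTIdeal_of_forall h0 fun J hJ0 hJ hJQ z hz => ?_⟩
  obtain ⟨f, hf, s, hs, hdvd⟩ := hD.exists_forall_dvd hM hJ
  have hs0 : s ≠ 0 := fun h => hs (h ▸ M.zero_mem)
  have hf0 : f ≠ 0 := by
    rintro rfl
    obtain ⟨j, hj, hj0⟩ := Submodule.exists_mem_ne_zero_of_ne_bot hJ0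
    exact mul_ne_zero hs0 hj0 (zero_dvd_iff.1 (hdvd j hj))
  have hf0' : algebraMap D K f ≠ 0 := by simpa using hf0
  -- `s / f ∈ J⁻¹`, so `z * s ∈ f D ⊆ Q` while `s ∉ Q`.
  have := mem_vClosure_iff.1 hz (algebraMap D K s / algebraMap D K f) fun e he => by
    obtain ⟨j, hj, rfl⟩ := (IsLocalization.mem_coeSubmodule K J).1 he
    obtain ⟨k, hk⟩ := hdvd j hj
    refine Submodule.mem_one.2 ⟨k, ?_⟩
    rw [div_mul_eq_mul_div, eq_div_iff hf0', ← map_mul, ← map_mul, hk, mul_comm]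
  obtain ⟨e, he⟩ := Submodule.mem_one.1 this
  rw [← mul_div_assoc, eq_div_iff hf0', ← map_mul, ← map_mul] at he
  have hzs : z * s ∈ Q := IsFractionRing.injective D K he ▸ Q.mul_mem_left e (hJQ hf)
  exact (hQ.mem_or_mem hzs).resolve_right fun h => hs (hQM h)

/-! ### Consequences of sharpness and the powers of `u`. -/

/-- A `t`-sharp prime of a PvMD contains a finitely generated ideal `G` such that every
`t`-maximal ideal above `G` is above the prime. -/
theorem IsPvMD.exists_fg_of_isTSharp (hD : IsPvMD D K) {Q : Ideal D} (hsharp : IsTSharp K Q) :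
    ∃ G : Ideal D, G.FG ∧ G ≤ Q ∧ ∀ N, IsTMaximal K N → G ≤ N → Q ≤ N := by
  obtain ⟨u, huT, huQ⟩ := Set.not_subset.1 hsharp
  obtain ⟨a, b, hb, rfl⟩ := IsFractionRing.div_surjective (A := D) u
  have hb0 : b ≠ 0 := nonZeroDivisors.ne_zero hb
  have hb0' : algebraMap D K b ≠ 0 := by simpa using hb0
  set J : Ideal D := Ideal.span {a, b} with hJ
  have haJ : a ∈ J := Ideal.subset_span (by simp)
  have hbJ : b ∈ J := Ideal.subset_span (by simp)
  have h1 := hD J ((Submodule.ne_bot_iff _).2 ⟨b, hbJ, hb0⟩) (Submodule.fg_span (Set.toFinite _))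
  have h1mem : (1 : K) ∈ tClosure
      (IsLocalization.coeSubmodule K J * (1 / IsLocalization.coeSubmodule K J)) := by
    rw [h1]
    exact Submodule.mem_one.2 ⟨1, map_one _⟩
  have hne : IsLocalization.coeSubmodule K J * (1 / IsLocalization.coeSubmodule K J) ≠ ⊥ := by
    refine (Submodule.ne_bot_iff _).2 ⟨algebraMap D K b * 1,
      Submodule.mul_mem_mul (algebraMap_mem_coeSubmodule.2 hbJ) ?_, by simpa using hb0⟩
    rw [Submodule.mem_div_iff_forall_mul_mem]
    intro y hy
    rw [one_mul]
    exact coeSubmodule_le_one J hy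
  obtain ⟨F, hF0, hF, hFle, hF1⟩ := (mem_tClosure_iff hne 1).1 h1mem
  obtain ⟨B, hB, hBf, hFB⟩ := exists_fg_le_mul hF hFle
  have hBmem : ∀ y ∈ B, ∀ j ∈ J, algebraMap D K j * y ∈ (1 : Submodule D K) := fun y hy j hj =>
    mul_comm y _ ▸ Submodule.mem_div_iff_forall_mul_mem.1 (hB hy) _
      (algebraMap_mem_coeSubmodule.2 hj)
  -- `G = b B`, where `B ⊆ J⁻¹` is finitely generated and `1 ∈ (J B)^v`.
  obtain ⟨G, hG⟩ := exists_coeSubmodule_eq (D := D) (K := K)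
    (E := Submodule.span D {algebraMap D K b} * B) <| by
      rw [Submodule.span_singleton_mul]
      rintro _ ⟨y, hy, rfl⟩
      exact hBmem y hy b hbJ
  refine ⟨G, (IsLocalization.coeSubmodule_fg K (IsFractionRing.injective D K) G).1
    (hG ▸ (Submodule.fg_span_singleton _).mul hBf), fun g hg => ?_, fun N hN hGN => ?_⟩
  · have hg' := algebraMap_mem_coeSubmodule (K := K).2 hg
    rw [hG, Submodule.span_singleton_mul] at hg'
    obtain ⟨y, hy, hyg⟩ := hg'
    have hyg : algebraMap D K b * y = algebraMap D K g := hyg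
    obtain ⟨e, he⟩ := Submodule.mem_one.1 (hBmem y hy a haJ)
    by_contra hgQ
    -- With `g = b y` and `e = a y`, the fraction `e / g` is `u`.
    refine huQ (mem_localizationAt_iff.2 ⟨e, g, hgQ, ?_⟩)
    rw [he, ← hyg]
    field_simp
  · by_contra hQN
    have hu : algebraMap D K a / algebraMap D K b ∈ localizationAt K N :=
      Set.mem_iInter₂.1 huT N ⟨hN, hQN⟩
    obtain ⟨c, s, hs, hcs⟩ := mem_localizationAt_iff.1 hu
    have hsa : s * a = b * c := by
      apply IsFractionRing.injective D K
      rw [← mul_div_assoc, div_eq_iff hb0'] at hcs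
      rw [map_mul, map_mul, hcs, mul_comm]
    have hs0 : algebraMap D K s ≠ 0 := by
      simpa using fun h : s = 0 => hs (h ▸ N.zero_mem)
    have hsJ : Submodule.span D {algebraMap D K s} * IsLocalization.coeSubmodule K J ≤
        Submodule.span D {algebraMap D K b} := by
      rw [Submodule.span_singleton_mul]
      rintro _ ⟨y, hy, rfl⟩
      obtain ⟨j, hj, rfl⟩ := (IsLocalization.mem_coeSubmodule K J).1 hy
      obtain ⟨r, t, rfl⟩ := Ideal.mem_span_pair.1 hj
      refine Submodule.mem_span_singleton.2 ⟨r * c + t * s, ?_⟩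
      rw [Algebra.smul_def, ← map_mul]
      change _ = algebraMap D K s * algebraMap D K _
      rw [← map_mul]
      congr 1
      linear_combination (-r) * hsa
    -- `s J ⊆ b D` gives `s F ⊆ s J B ⊆ b B = G ⊆ N`; with `1 ∈ F^v` this forces `s ∈ (s F)^v ⊆ N`.
    have hle : Submodule.span D {algebraMap D K s} * F ≤ IsLocalization.coeSubmodule K N := by
      refine le_trans ?_ (IsLocalization.coeSubmodule_mono K hGN)
      rw [hG]
      refine (mul_le_mul' le_rfl hFB).trans ?_
      rw [← mul_assoc]
      exact mul_le_mul' hsJ le_rfl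
    refine hs (algebraMap_mem_coeSubmodule.1 (hN.1.2.vClosure_le (K := K) ?_
      ((Submodule.fg_span_singleton _).mul hF) hle ?_))
    · obtain ⟨f, hf, hf0⟩ := Submodule.exists_mem_ne_zero_of_ne_bot hF0
      exact (Submodule.ne_bot_iff _).2 ⟨_, Submodule.mul_mem_mul
        (Submodule.mem_span_singleton_self _) hf, mul_ne_zero hs0 hf0⟩
    · refine mem_vClosure_iff.2 fun y hy => ?_
      rw [← one_mul (_ * y)]
      refine mem_vClosure_iff.1 hF1 _ fun f hf => ?_
      convert hy _ (Submodule.mul_mem_mul (Submodule.mem_span_singleton_self _) hf) using 1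
      ring

/-- In a PvMD, if `u ∈ D_P` and `u ∈ D_N` for every `t`-maximal ideal `N` not containing the
prime `P`, then every power of `u` lies in `P⁻¹`. -/
theorem IsPvMD.pow_mul_mem_one (hD : IsPvMD D K) {P : Ideal D} (hP : P.IsPrime) {u : K}
    (hu : u ∈ localizationAt K P) (huT : u ∈ tTheta K P) (n : ℕ) {p : D} (hp : p ∈ P) :
    u ^ n * algebraMap D K p ∈ (1 : Submodule D K) := by
  refine mem_one_of_forall_isTMaximal fun N hN => ?_
  have hN' := hN.isTPrime
  by_cases hPN : P ≤ N
  · by_contra hy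
    obtain ⟨c, -, t, ht, hct⟩ := hD.exists_eq_div hN' hy
    obtain ⟨a, s, hs, has⟩ := mem_localizationAt_iff.1 (pow_mem_localizationAt hP hu n)
    -- Here `u ^ n * p = t / c` and `u ^ n = a / s` with `s ∉ P`, so `t ∈ P ≤ N`, against `t ∉ N`.
    have hst : s * t = c * a * p := by
      apply IsFractionRing.injective D K
      rw [map_mul, map_mul, map_mul, ← hct, ← has]
      ring
    have : s * t ∈ P := hst ▸ P.mul_mem_left _ hp
    exact ht (hPN ((hP.mem_or_mem this).resolve_left hs))
  · exact mul_mem_localizationAt hN'.1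
      (pow_mem_localizationAt hN'.1 (Set.mem_iInter₂.1 huT N ⟨hN, hPN⟩) n)
      (algebraMap_mem_localizationAt hN'.1 p)

/-- If `D_M` is a valuation domain and `u ∉ D_M`, the elements of `D` lying in every
`u⁻ⁿ D_M` form a prime ideal. -/
theorem IsPvMD.exists_isPrime_mem_iff (hD : IsPvMD D K) {M : Ideal D} (hM : IsTPrime K M) {u : K}
    (hu : u ∉ localizationAt K M) :
    ∃ R : Ideal D, R.IsPrime ∧
      ∀ d, d ∈ R ↔ ∀ n : ℕ, algebraMap D K d * u ^ n ∈ localizationAt K M := by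
  have hmul := fun {x y : K} => mul_mem_localizationAt (x := x) (y := y) hM.1
  let R : Ideal D :=
    { carrier := {d | ∀ n : ℕ, algebraMap D K d * u ^ n ∈ localizationAt K M}
      add_mem' := fun {a b} ha hb n => by
        rw [map_add, add_mul]
        exact add_mem_localizationAt hM.1 (ha n) (hb n)
      zero_mem' := fun n => by
        rw [map_zero, zero_mul, ← map_zero (algebraMap D K)]
        exact algebraMap_mem_localizationAt hM.1 0
      smul_mem' := fun c d hd n => by
        rw [smul_eq_mul, map_mul, mul_assoc]
        exact hmul (algebraMap_mem_localizationAt hM.1 c) (hd n) }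
  have memR : ∀ d, d ∈ R ↔ ∀ n : ℕ, algebraMap D K d * u ^ n ∈ localizationAt K M :=
    fun d => Iff.rfl
  refine ⟨R, ⟨?_, fun {d e} hde => ?_⟩, memR⟩
  · rw [Ideal.ne_top_iff_one, memR]
    exact fun h => hu (by simpa using h 1)
  · by_contra! hcon
    rw [memR, memR] at hcon
    push Not at hcon
    obtain ⟨⟨n, hn⟩, m, hm⟩ := hcon
    obtain ⟨c, hc, t, ht, h⟩ := hD.exists_eq_div hM hn
    obtain ⟨c', -, t', ht', h'⟩ := hD.exists_eq_div hM hm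
    obtain ⟨a, r, hr, h''⟩ := mem_localizationAt_iff.1 ((memR _).1 hde (n + m))
    -- The inverses of `d * u ^ n` and `e * u ^ m` are `c / t` and `c' / t'`, and their product `d *
    -- e * u ^ (n + m)` is `a / r`. The right side is in `M`, no factor on the left is.
    have hprod : t * t' * r = a * c' * c := by
      apply IsFractionRing.injective D K
      simp only [map_mul, ← h, ← h', ← h'', pow_add]
      ring
    have hmem : t * t' * r ∈ M := hprod ▸ M.mul_mem_left _ hc
    exact ((hM.1.mem_or_mem hmem).elim (fun h => (hM.1.mem_or_mem h).elim ht ht') hr)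

/-! ### The contradiction at a `t`-maximal ideal above `P`. -/

theorem IsPvMD.notMem_vClosure (hD : IsPvMD D K) (hsharp : IsTDoublesharp D K) {P M : Ideal D}
    (hP : IsTPrime K P) (hM : IsTMaximal K M) (hPM : P ≤ M) {x : D} (hxM : x ∈ M) (hxP : x ∉ P) :
    algebraMap D K x ∉ vClosure (IsLocalization.coeSubmodule K P) := by
  intro hx
  have hM' := hM.isTPrime
  have := hM'.1
  obtain ⟨Q, hQ, hQM⟩ := Ideal.exists_minimalPrimes_le (I := P ⊔ Ideal.span {x}) (J := M)
    (sup_le hPM ((Ideal.span_singleton_le_iff_mem M).2 hxM))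
  have hQp : Q.IsPrime := hQ.1.1
  have hPQ : P ≤ Q := le_sup_left.trans hQ.1.2
  have hxQ : x ∈ Q := hQ.1.2 (Submodule.mem_sup_right (Ideal.mem_span_singleton_self x))
  have hQt := hD.isTPrime_of_le hM' hQp (fun h => hP.2.1 (le_bot_iff.1 (h ▸ hPQ))) hQM
  obtain ⟨G, hG, hGQ, hGN⟩ := hD.exists_fg_of_isTSharp (hsharp Q hQt)
  obtain ⟨g, hg, s, hs, hdvd⟩ :=
    hD.exists_forall_dvd hM' (Submodule.FG.sup hG (Submodule.fg_span_singleton x))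
  have hgQ : g ∈ Q :=
    (sup_le hGQ ((Ideal.span_singleton_le_iff_mem Q).2 hxQ) : G ⊔ Ideal.span {x} ≤ Q) hg
  have hs0 : s ≠ 0 := fun h => hs (h ▸ M.zero_mem)
  have hx0 : x ≠ 0 := fun h => hxP (h ▸ P.zero_mem)
  have hxG : x ∈ G ⊔ Submodule.span D {x} :=
    Submodule.mem_sup_right (Submodule.mem_span_singleton_self x)
  have hg0 : algebraMap D K g ≠ 0 := by
    have : g ≠ 0 := by
      rintro rfl
      exact mul_ne_zero hs0 hx0 (zero_dvd_iff.1 (hdvd x hxG))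
    simpa using this
  set u : K := algebraMap D K s / algebraMap D K g with hu
  have hgu : algebraMap D K g * u = algebraMap D K s := mul_div_cancel₀ _ hg0
  have huG : ∀ j ∈ G ⊔ Submodule.span D {x}, ∀ N : Ideal D, j ∉ N → u ∈ localizationAt K N := by
    intro j hj N hjN
    obtain ⟨k, hk⟩ := hdvd j hj
    refine mem_localizationAt_iff.2 ⟨k, j, hjN, mul_left_cancel₀ hg0 ?_⟩
    rw [← map_mul, ← hk, mul_left_comm, hgu, map_mul, mul_comm]
  have huQ : u ∉ localizationAt K Q := fun h => by
    obtain ⟨a, t, ht, hat⟩ := mem_localizationAt_iff.1 h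
    have : t * s = a * g := by
      apply IsFractionRing.injective D K
      rw [map_mul, map_mul, ← hat, ← hgu]
      ring
    have hts : t * s ∈ Q := this ▸ Q.mul_mem_left a hgQ
    exact (hQp.mem_or_mem hts).elim ht fun h => hs (hQM h)
  have huM : u ∉ localizationAt K M := fun h => huQ (localizationAt_anti hQM h)
  have huP : u ∈ localizationAt K P := huG x hxG P hxP
  -- If `N` is not above `P` it is not above `Q`, hence not above `G`.
  have huT : u ∈ tTheta K P := Set.mem_iInter₂.2 fun N hN => by
    obtain ⟨j, hj, hjN⟩ := SetLike.not_le_iff_exists.1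
      fun h : G ≤ N => hN.2 (hPQ.trans (hGN N hN.1 h))
    exact huG j (Submodule.mem_sup_left hj) N hjN
  have hpow := fun n (p : D) (hp : p ∈ P) => hD.pow_mul_mem_one hP.1 huP huT n hp
  have hone : ∀ y ∈ (1 : Submodule D K), y ∈ localizationAt K M := fun y hy => by
    obtain ⟨d, rfl⟩ := Submodule.mem_one.1 hy
    exact algebraMap_mem_localizationAt hM'.1 d
  obtain ⟨R, hR, memR⟩ := hD.exists_isPrime_mem_iff hM' huM
  have hPR : P ≤ R := fun p hp => (memR p).2 fun n => hone _ (mul_comm (u ^ n) _ ▸ hpow n p hp)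
  have hxR : x ∈ R := (memR x).2 fun n => hone _ <| mem_vClosure_iff.1 hx _ fun e he => by
    obtain ⟨p, hp, rfl⟩ := (IsLocalization.mem_coeSubmodule K P).1 he
    exact hpow n p hp
  -- For `d ∉ Q`, `d * u ∈ D_M ⊆ D_Q` would put `u` in `D_Q`.
  have hRQ : R ≤ Q := fun d hd => by
    by_contra hdQ
    obtain ⟨a, t, ht, hat⟩ := mem_localizationAt_iff.1
      (localizationAt_anti hQM ((memR d).1 hd 1))
    refine huQ (mem_localizationAt_iff.2 ⟨a, t * d,
      fun h => (hQp.mem_or_mem h).elim ht hdQ, ?_⟩)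
    rw [← hat, map_mul]
    ring
  have hgR : g ∈ R :=
    hQ.2 ⟨hR, sup_le hPR ((Ideal.span_singleton_le_iff_mem R).2 hxR)⟩ hRQ hgQ
  -- The exponent is 2 because `g * u = s` is a unit of `D_M`, so `g * u ^ 2 = s * u` recovers `u`.
  obtain ⟨a, t, ht, hat⟩ := mem_localizationAt_iff.1 ((memR g).1 hgR 2)
  refine huM (mem_localizationAt_iff.2 ⟨a, t * s,
    fun h => (hM'.1.mem_or_mem h).elim ht hs, ?_⟩)
  rw [← hat, map_mul, ← hgu]
  ring

end TOperation

theorem mainTheorem10 {D : Type*} [CommRing D] [IsDomain D] (K : Type*) [Field K] [Algebra D K]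
    [IsFractionRing D K] (hD : TOperation.IsPvMD D K) (hsharp : TOperation.IsTDoublesharp D K)
    (P : Ideal D) (hP : TOperation.IsTPrime K P) (hmax : ¬ TOperation.IsTMaximal K P) :
    TOperation.IsDivisorial K P := by
  obtain ⟨M, hPM, hM⟩ := hP.2.exists_le_isTMaximal hP.1.ne_top
  refine ⟨hP.2.1, le_antisymm (fun z hz => ?_) (TOperation.le_vClosure _)⟩
  obtain ⟨x, rfl⟩ := Submodule.mem_one.1
    (TOperation.vClosure_le_one (TOperation.coeSubmodule_le_one P) hz)
  rw [TOperation.algebraMap_mem_coeSubmodule]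
  by_contra hxP
  -- Multiplying by `y ∈ M \ P` moves `x` into `M` while keeping it in `P^v` and outside `P`; such a
  -- `y` exists because `P` is not `t`-maximal.
  obtain ⟨y, hyM, hyP⟩ := SetLike.not_le_iff_exists.1
    fun h : M ≤ P => hmax (le_antisymm hPM h ▸ hM)
  refine hD.notMem_vClosure hsharp hP hM hPM (M.mul_mem_right x hyM)
    (fun h => (hP.1.mem_or_mem h).elim hyP hxP) ?_
  rw [map_mul, ← Algebra.smul_def]
  exact Submodule.smul_mem _ y hz
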